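/- Let $0<a\le b\le 2$, let $\alpha:\mathbf R\to[a,b]$ be Lebesgue measurable (for instance continuous), and let $0<H<1$ and $\lambda>0$. Let $\mathcal F_\alpha$ be the variable exponent Lebesgue space of measurable $f:\mathbf R\to\mathbf R$ with $\|f\|_\alpha=\inf\{r>0:\int_{-\infty}^{\infty}|f(x)/r|^{\alpha(x)}\,dx\le 1\}<\infty$. The multistable stochastic integral $I(f)=\int f\,dM_\alpha$, $f\in\mathcal F_\alpha$, is the real-valued process whose finite-dimensional distributions are given by $$\mathbf E\Big[e^{i\sum_{k=1}^d\theta_k I(f_k)}\Big]=\exp\Big\{-\int_{-\infty}^{\infty}\Big|\sum_{k=1}^d\theta_k f_k(x)\Big|^{\alpha(x)}dx\Big\},\qquad f_1,\dots,f_d\in\mathcal F_\alpha,\ \theta_1,\dots,\theta_d\in\mathbf R.$$ A linear tempered fractional multistable motion (LTFmSM) is a process $X(t)$, $t\in\mathbf R$, on a probability space with $$X(t)=\int_{-\infty}^{\infty}\Big[e^{-\lambda(t-x)_+}(t-x)_+^{H-\frac1{\alpha(x)}}-e^{-\lambda(-x)_+}(-x)_+^{H-\frac1{\alpha(x)}}\Big]dM_\alpha(x),$$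 that is, with the finite-dimensional distributions of this family of integrals, where $(x)_+=\max\{x,0\}$ and $0^\gamma=0$ for all $\gamma\in\mathbf R$. If $a>1$ and $Ha>1$, then every LTFmSM $X$ has a version $Y$ (that is, $\mathbf P(Y(t)=X(t))=1$ for every $t\in\mathbf R$) all of whose paths are continuous, and such that for every $0<\beta<H-1/a$, almost surely, the path $t\mapsto Y(t)$ is $\beta$-Hölder continuous on each bounded interval. -/

import Mathlib

open MeasureTheory
open scoped ENNReal NNReal

namespace Multistable

noncomputable section

/-- The quasinorm of the variable exponent Lebesgue space `F_α`: the number `r > 0` at which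
`∫ |f x / r| ^ α x dx` reaches the value `1` (in the usual form, as the infimum of the `r > 0` at
which this integral is at most `1`, so that the zero function has quasinorm `0`, and the quasinorm
is `∞` if there is no such `r`). -/
def quasinorm (α f : ℝ → ℝ) : ℝ≥0∞ :=
  ⨅ (r : ℝ) (_ : 0 < r) (_ : ∫⁻ x, ENNReal.ofReal (|f x / r| ^ α x) ≤ 1), ENNReal.ofReal r

/-- Membership in the variable exponent Lebesgue space `F_α`: the Lebesgue measurable functions
with finite quasinorm. -/
def MemF (α f : ℝ → ℝ) : Prop :=
  AEMeasurable f volume ∧ quasinorm α f < ∞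

/-- `X` is (a realization on `(Ω, P)` of) the multistable stochastic integral process
`i ↦ ∫ f i x dM_α(x)`. The multistable integral of integrands in `F_α` is given by its
finite-dimensional distributions, through the characteristic function
`E exp(i ∑ θ_k I(f_k)) = exp(-∫ |∑ θ_k f_k(x)| ^ α(x) dx)`. -/
structure IsMultistableIntegral {Ω : Type*} [MeasurableSpace Ω] (P : Measure Ω)
    (α : ℝ → ℝ) {ι : Type*} (f : ι → ℝ → ℝ) (X : ι → Ω → ℝ) : Prop where
  measurable : ∀ i, Measurable (X i)
  charFun_eq : ∀ (d : ℕ) (i : Fin d → ι) (θ : Fin d → ℝ), (∀ k, MemF α (f (i k))) →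
    ∫ ω, Complex.exp (Complex.I * ((∑ k, θ k * X (i k) ω : ℝ) : ℂ)) ∂P
      = Complex.exp (-((∫ x, |∑ k, θ k * f (i k) x| ^ α x : ℝ) : ℂ))

/-- `(y)_+ ^ γ`, with the convention `0 ^ γ = 0` for every real `γ`. -/
def posPow (y γ : ℝ) : ℝ := if 0 < y then y ^ γ else 0

/-- The kernel
`G(t, x) = e^{-λ (t-x)_+} (t-x)_+^{H - 1/α(x)} - e^{-λ (-x)_+} (-x)_+^{H - 1/α(x)}`. -/
def kernel (H : ℝ) (α : ℝ → ℝ) (lam : ℝ) (t x : ℝ) : ℝ :=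
  Real.exp (-lam * max (t - x) 0) * posPow (t - x) (H - 1 / α x)
    - Real.exp (-lam * max (-x) 0) * posPow (-x) (H - 1 / α x)

/-- `X` is a linear tempered fractional multistable motion with parameters `H`, `α`, `lam`: the
multistable stochastic integral of the kernels `G(t, ·)`, `t ∈ ℝ`. -/
def IsLTFmSM {Ω : Type*} [MeasurableSpace Ω] (P : Measure Ω) (H : ℝ) (α : ℝ → ℝ) (lam : ℝ)
    (X : ℝ → Ω → ℝ) : Prop :=
  IsMultistableIntegral P α (kernel H α lam) X

end

end Multistable

/-! Moments of the increments of order at least `a` need not be finite, so Kolmogorov's criterion is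
run on tails: `P(|X t - X s| > y) ≤ C (|t - s| ^ H / y) ^ a`. The tail bound
(`IsLTFmSM.measureReal_increment_le`) comes from the characteristic function `exp (-J θ)` of the
increment. Divided by `|t - s| ^ H` and raised to the power `α x`, the kernel increment has a
majorant whose integral depends neither on `s, t` nor on `α` (`temperedPow_increment_le`,
`integral_incrementMajorant`). Hence `J θ ≤ C (|θ| |t - s| ^ H) ^ a` whenever `|θ| |t - s| ^ H ≤ 1`,
and integrating `1 - exp (-J θ)` over `|θ| ≤ 2 / y` bounds the tail. At level `n` a bounded interval
has `O(2 ^ n)` dyadic increments, each above `2 ^ (-nβ)` with probability `O(2 ^ (-n (H - β) a))`.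
The sum over `n` converges exactly when `β < H - 1 / a`; Borel–Cantelli and chaining along dyadic
points conclude. -/

open Filter Topology

namespace Multistable

/-! ### Deterministic chaining along dyadic points -/

/-- The largest multiple of `2⁻ⁿ` that is at most `t`. -/
noncomputable def dyadicFloor (n : ℕ) (t : ℝ) : ℝ := ⌊2 ^ n * t⌋ / 2 ^ n

/-- On every bounded interval, the increments of `f` between neighbouring points of `2⁻ⁿ ℤ` are
at most `2 ^ (-n β)` for all large `n`. -/
def DyadicHolder (β : ℝ) (f : ℝ → ℝ) : Prop :=
  ∀ K : ℕ, ∀ᶠ n : ℕ in atTop, ∀ k : ℤ, |(k : ℝ)| ≤ K * 2 ^ n →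
    |f ((k + 1) / 2 ^ n) - f (k / 2 ^ n)| ≤ ((2 : ℝ) ^ (-β)) ^ n

lemma two_rpow_neg_lt_one {β : ℝ} (hβ : 0 < β) : (2 : ℝ) ^ (-β) < 1 :=
  Real.rpow_lt_one_of_one_lt_of_neg one_lt_two (by linarith)

lemma dyadicFloor_le (n : ℕ) (t : ℝ) : dyadicFloor n t ≤ t := by
  rw [dyadicFloor, div_le_iff₀ (by positivity), mul_comm t]
  exact Int.floor_le _

lemma abs_sub_dyadicFloor_le (n : ℕ) (t : ℝ) : |t - dyadicFloor n t| ≤ 1 / 2 ^ n := by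
  rw [abs_of_nonneg (sub_nonneg.2 (dyadicFloor_le n t)), dyadicFloor, sub_le_iff_le_add, ← add_div,
    le_div_iff₀ (by positivity), mul_comm t]
  linarith [Int.lt_floor_add_one ((2 : ℝ) ^ n * t)]

lemma abs_floor_two_pow_mul_le {K : ℕ} {t : ℝ} (ht : |t| ≤ K) (n : ℕ) :
    |(⌊2 ^ n * t⌋ : ℝ)| ≤ K * 2 ^ n := by
  have h2 : (0 : ℝ) < 2 ^ n := by positivity
  obtain ⟨h3, h4⟩ := abs_le.1 ht
  rw [abs_le]
  constructor
  · have : -((K : ℤ) * 2 ^ n) ≤ ⌊2 ^ n * t⌋ := by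
      rw [Int.le_floor]
      push_cast
      nlinarith
    exact_mod_cast this
  · exact (Int.floor_le _).trans (by nlinarith)

/-- Halving the mesh either keeps the floor or moves it to the right neighbour on the finer grid:
`⌊2 ^ (n + 1) * t⌋` is `2 * k` or `2 * k + 1`. -/
lemma abs_dyadicFloor_succ_sub_le {f : ℝ → ℝ} {K n : ℕ} {ε : ℝ} (hε : 0 ≤ ε)
    (h : ∀ k : ℤ, |(k : ℝ)| ≤ K * 2 ^ (n + 1) →
      |f ((k + 1) / 2 ^ (n + 1)) - f (k / 2 ^ (n + 1))| ≤ ε) {t : ℝ} (ht : |t| ≤ K) :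
    |f (dyadicFloor (n + 1) t) - f (dyadicFloor n t)| ≤ ε := by
  set k : ℤ := ⌊2 ^ n * t⌋ with hk
  have hkK : |(k : ℝ)| ≤ K * 2 ^ n := abs_floor_two_pow_mul_le ht n
  have h0 : dyadicFloor n t = ((2 * k : ℤ) : ℝ) / 2 ^ (n + 1) := by
    rw [dyadicFloor, ← hk, pow_succ]
    push_cast
    field_simp
  have h1 : (k : ℝ) ≤ 2 ^ n * t := Int.floor_le _
  have h2 : 2 ^ n * t < k + 1 := Int.lt_floor_add_one _
  have h3 : ⌊(2 : ℝ) ^ (n + 1) * t⌋ = 2 * k ∨ ⌊(2 : ℝ) ^ (n + 1) * t⌋ = 2 * k + 1 := by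
    have h4 : 2 * k ≤ ⌊(2 : ℝ) ^ (n + 1) * t⌋ := by
      rw [Int.le_floor, pow_succ]
      push_cast
      linarith
    have h5 : ⌊(2 : ℝ) ^ (n + 1) * t⌋ < 2 * k + 2 := by
      rw [Int.floor_lt, pow_succ]
      push_cast
      linarith
    omega
  rw [h0]
  rcases h3 with h3 | h3
  · rw [dyadicFloor, h3]
    simpa using hε
  · rw [dyadicFloor, h3]
    have := h (2 * k) (by
      push_cast
      rw [abs_mul, pow_succ]
      norm_num
      linarith)
    push_cast at this ⊢
    exact this

lemma abs_dyadicFloor_sub_le {f : ℝ → ℝ} {K n : ℕ} {ε : ℝ} (hε : 0 ≤ ε)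
    (h : ∀ k : ℤ, |(k : ℝ)| ≤ K * 2 ^ n → |f ((k + 1) / 2 ^ n) - f (k / 2 ^ n)| ≤ ε)
    {s t : ℝ} (hs : |s| ≤ K) (hst : s ≤ t) (hst' : t - s ≤ 1 / 2 ^ n) :
    |f (dyadicFloor n t) - f (dyadicFloor n s)| ≤ ε := by
  have h2 : (0 : ℝ) < 2 ^ n := by positivity
  have h3 : (2 : ℝ) ^ n * t ≤ 2 ^ n * s + 1 := by
    rw [le_div_iff₀ h2] at hst'
    linarith
  have h4 : ⌊(2 : ℝ) ^ n * s⌋ ≤ ⌊(2 : ℝ) ^ n * t⌋ :=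
    Int.floor_le_floor (mul_le_mul_of_nonneg_left hst h2.le)
  have h5 : ⌊(2 : ℝ) ^ n * t⌋ ≤ ⌊(2 : ℝ) ^ n * s⌋ + 1 := by
    rw [← Int.floor_add_one]
    exact Int.floor_le_floor h3
  have h6 : ⌊(2 : ℝ) ^ n * t⌋ = ⌊(2 : ℝ) ^ n * s⌋ ∨
      ⌊(2 : ℝ) ^ n * t⌋ = ⌊(2 : ℝ) ^ n * s⌋ + 1 := by omega
  rcases h6 with h6 | h6
  · simpa [dyadicFloor, h6] using hε
  · rw [dyadicFloor, dyadicFloor, h6]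
    push_cast
    exact h _ (abs_floor_two_pow_mul_le hs n)

/-- The threshold `N` is uniform in `t`, which later makes the limit uniformly close to its dyadic
approximations. -/
lemma DyadicHolder.exists_dist_le_geometric {β : ℝ} {f : ℝ → ℝ} (hf : DyadicHolder β f) (K : ℕ) :
    ∃ N : ℕ, ∀ t : ℝ, |t| ≤ K → ∀ n ≥ N, ∀ m : ℕ,
      dist (f (dyadicFloor (n + m) t)) (f (dyadicFloor (n + (m + 1)) t))
        ≤ ((2 : ℝ) ^ (-β)) ^ (n + 1) * ((2 : ℝ) ^ (-β)) ^ m := by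
  obtain ⟨N, hN⟩ := eventually_atTop.1 (hf K)
  refine ⟨N, fun t ht n hn m => ?_⟩
  rw [dist_comm, Real.dist_eq, ← pow_add, ← add_assoc, add_right_comm n 1 m]
  exact abs_dyadicFloor_succ_sub_le (by positivity) (hN (n + m + 1) (by omega)) ht

lemma DyadicHolder.exists_tendsto {β : ℝ} (hβ : 0 < β) {f : ℝ → ℝ} (hf : DyadicHolder β f)
    (t : ℝ) : ∃ y, Tendsto (fun n => f (dyadicFloor n t)) atTop (𝓝 y) := by
  obtain ⟨K, hK⟩ := exists_nat_ge |t|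
  obtain ⟨N, hN⟩ := hf.exists_dist_le_geometric K
  obtain ⟨y, hy⟩ := cauchySeq_tendsto_of_complete
    (cauchySeq_of_le_geometric _ _ (two_rpow_neg_lt_one hβ) (hN t hK N le_rfl))
  refine ⟨y, (tendsto_add_atTop_iff_nat N).1 ?_⟩
  simpa only [add_comm N] using hy

/-- Pass from `s` to `t` through their floors at level `n`: two geometric tails of size `ρ ^ (n + 1)
/ (1 - ρ)` and one step between equal or adjacent grid points. -/
lemma DyadicHolder.exists_dist_limit_le {β : ℝ} (hβ : 0 < β) {f g : ℝ → ℝ}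
    (hf : DyadicHolder β f)
    (hg : ∀ t, Tendsto (fun n => f (dyadicFloor n t)) atTop (𝓝 (g t))) (K : ℕ) :
    ∃ (N : ℕ) (M : ℝ), 0 ≤ M ∧ ∀ n ≥ N, ∀ s t : ℝ, |s| ≤ K → |t| ≤ K → |t - s| ≤ 1 / 2 ^ n →
      |g t - g s| ≤ M * ((2 : ℝ) ^ (-β)) ^ n := by
  set ρ : ℝ := (2 : ℝ) ^ (-β) with hρ
  have hρ0 : 0 < ρ := by positivity
  have hρ1 : ρ < 1 := two_rpow_neg_lt_one hβ
  have hρ2 : 0 < 1 - ρ := by linarith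
  obtain ⟨N, hN⟩ := hf.exists_dist_le_geometric K
  obtain ⟨N', hN'⟩ := eventually_atTop.1 (hf K)
  have key : ∀ n ≥ N, ∀ t : ℝ, |t| ≤ K → |f (dyadicFloor n t) - g t| ≤ ρ ^ (n + 1) / (1 - ρ) := by
    intro n hn t ht
    have := dist_le_of_le_geometric_of_tendsto₀ ρ _ hρ1 (hN t ht n hn)
      (by simpa only [add_comm n] using (tendsto_add_atTop_iff_nat n).2 (hg t))
    simpa [Real.dist_eq] using this
  have main : ∀ n ≥ max N N', ∀ s t : ℝ, |s| ≤ K → |t| ≤ K → s ≤ t → t - s ≤ 1 / 2 ^ n →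
      |g t - g s| ≤ (2 * ρ / (1 - ρ) + 1) * ρ ^ n := by
    intro n hn s t hs ht hst hst'
    have h1 := abs_le.1 (key n (le_of_max_le_left hn) s hs)
    have h2 := abs_le.1 (key n (le_of_max_le_left hn) t ht)
    have h3 := abs_le.1 (abs_dyadicFloor_sub_le (by positivity) (hN' n (le_of_max_le_right hn))
      hs hst hst')
    have h4 : (2 * ρ / (1 - ρ) + 1) * ρ ^ n = 2 * (ρ ^ (n + 1) / (1 - ρ)) + ρ ^ n := by
      field_simp
      ring
    rw [h4, abs_le]
    constructor <;> linarith
  refine ⟨max N N', 2 * ρ / (1 - ρ) + 1, by positivity, fun n hn s t hs ht hst => ?_⟩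
  rcases le_total s t with h | h
  · exact main n hn s t hs ht h ((le_abs_self _).trans hst)
  · rw [abs_sub_comm]
    exact main n hn t s ht hs h ((le_abs_self _).trans (by rwa [abs_sub_comm]))

lemma DyadicHolder.continuous_limit {β : ℝ} (hβ : 0 < β) {f g : ℝ → ℝ}
    (hf : DyadicHolder β f)
    (hg : ∀ t, Tendsto (fun n => f (dyadicFloor n t)) atTop (𝓝 (g t))) : Continuous g := by
  rw [continuous_iff_continuousAt]
  intro t
  obtain ⟨K, hK⟩ := exists_nat_ge (|t| + 1)
  obtain ⟨N, M, hM, h⟩ := hf.exists_dist_limit_le hβ hg K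
  rw [Metric.continuousAt_iff]
  intro ε hε
  have hlim : Tendsto (fun n => M * ((2 : ℝ) ^ (-β)) ^ n) atTop (𝓝 (M * 0)) :=
    (tendsto_pow_atTop_nhds_zero_of_lt_one (by positivity) (two_rpow_neg_lt_one hβ)).const_mul M
  rw [mul_zero] at hlim
  obtain ⟨n, hn, hnN⟩ := ((hlim.eventually_lt_const hε).and (eventually_ge_atTop N)).exists
  refine ⟨1 / 2 ^ n, by positivity, fun {s} hs => ?_⟩
  rw [Real.dist_eq] at hs ⊢
  refine (h n hnN t s (by linarith [abs_nonneg t]) ?_ hs.le).trans_lt hn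
  have h1 : (1 : ℝ) / 2 ^ n ≤ 1 := by
    rw [div_le_one (by positivity)]
    exact one_le_pow₀ one_le_two
  have h2 := abs_add_le (s - t) t
  rw [sub_add_cancel] at h2
  linarith

lemma exists_two_pow_near {x : ℝ} (hx : 0 < x) {N : ℕ} (hxN : x ≤ 1 / 2 ^ N) :
    ∃ n ≥ N, x ≤ 1 / 2 ^ n ∧ 1 / 2 ^ (n + 1) < x := by
  have hx1 : x ≤ 1 := hxN.trans (by
    rw [div_le_one (by positivity)]
    exact one_le_pow₀ one_le_two)
  obtain ⟨n, hn1, hn2⟩ := exists_nat_pow_near_of_lt_one hx hx1 (y := (1 / 2 : ℝ))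
    (by norm_num) (by norm_num)
  rw [one_div_pow] at hn1 hn2
  refine ⟨n, ?_, hn2, hn1⟩
  by_contra hlt
  have h1 : (2 : ℝ) ^ (n + 1) ≤ 2 ^ N := pow_le_pow_right₀ one_le_two (by omega)
  have h2 : (1 : ℝ) / 2 ^ N ≤ 1 / 2 ^ (n + 1) := one_div_le_one_div_of_le (by positivity) h1
  linarith

/-- Close points are compared at the level `n` with `2 ^ (-(n + 1)) < |t - s| ≤ 2 ^ (-n)`; for
distant ones the bound of `g` on the compact interval suffices. -/
lemma DyadicHolder.exists_holderOnWith_limit {β : ℝ≥0} (hβ : 0 < β) {f g : ℝ → ℝ}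
    (hf : DyadicHolder β f)
    (hg : ∀ t, Tendsto (fun n => f (dyadicFloor n t)) atTop (𝓝 (g t))) (c d : ℝ) :
    ∃ C : ℝ≥0, HolderOnWith C β g (Set.Icc c d) := by
  have hβ' : 0 < (β : ℝ) := hβ
  obtain ⟨K, hK⟩ := exists_nat_ge (max |c| |d|)
  have hmem : ∀ t ∈ Set.Icc c d, |t| ≤ K := fun t ht =>
    (abs_le_max_abs_abs ht.1 ht.2).trans hK
  obtain ⟨N, M, hM, h⟩ := hf.exists_dist_limit_le hβ' hg K
  obtain ⟨B, hB⟩ := isCompact_Icc.exists_bound_of_continuousOn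
    (hf.continuous_limit hβ' hg).continuousOn (s := Set.Icc c d)
  have hpos : (0 : ℝ) < (1 / 2 ^ N : ℝ) ^ (β : ℝ) := by positivity
  have key : ∀ s ∈ Set.Icc c d, ∀ t ∈ Set.Icc c d, |g t - g s| ≤
      max (M * 2 ^ (β : ℝ)) (2 * B / (1 / 2 ^ N : ℝ) ^ (β : ℝ)) * |t - s| ^ (β : ℝ) := by
    intro s hs t ht
    rcases eq_or_ne t s with rfl | hne
    · simp [Real.zero_rpow hβ'.ne']
    have hx : 0 < |t - s| := abs_pos.2 (sub_ne_zero.2 hne)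
    rcases le_or_gt |t - s| (1 / 2 ^ N) with hle | hgt
    · obtain ⟨n, hnN, hn1, hn2⟩ := exists_two_pow_near hx hle
      refine (h n hnN s t (hmem s hs) (hmem t ht) hn1).trans ?_
      refine le_trans ?_ (mul_le_mul_of_nonneg_right (le_max_left _ _) (by positivity))
      rw [mul_assoc]
      refine mul_le_mul_of_nonneg_left ?_ hM
      rw [← Real.mul_rpow (by norm_num) hx.le, ← Real.rpow_natCast, ← Real.rpow_mul (by norm_num),
        mul_comm, neg_eq_neg_one_mul, ← mul_assoc, Real.rpow_mul (by norm_num)]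
      refine Real.rpow_le_rpow (by positivity) ?_ hβ'.le
      rw [mul_neg_one, Real.rpow_neg (by norm_num), Real.rpow_natCast]
      rw [pow_succ] at hn2
      have : ((2 : ℝ) ^ n)⁻¹ = 2 * (1 / (2 ^ n * 2)) := by field_simp
      rw [this]
      linarith
    · have h1 := abs_le.1 (hB s hs)
      have h2 := abs_le.1 (hB t ht)
      have h3 : |g t - g s| ≤ 2 * B := by
        rw [abs_le]
        constructor <;> linarith
      have hB0 : 0 ≤ 2 * B := (abs_nonneg _).trans h3
      refine (h3.trans ?_).trans
        (mul_le_mul_of_nonneg_right (le_max_right _ _) (by positivity))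
      rw [div_mul_eq_mul_div, le_div_iff₀ hpos]
      exact mul_le_mul_of_nonneg_left (Real.rpow_le_rpow (by positivity) hgt.le hβ'.le) hB0
  refine ⟨(max (M * 2 ^ (β : ℝ)) (2 * B / (1 / 2 ^ N : ℝ) ^ (β : ℝ))).toNNReal,
    fun s hs t ht => ?_⟩
  rw [edist_dist, edist_dist, ENNReal.ofReal_rpow_of_nonneg dist_nonneg hβ'.le]
  change _ ≤ ENNReal.ofReal _ * _
  rw [← ENNReal.ofReal_mul (le_max_of_le_left (by positivity))]
  exact ENNReal.ofReal_le_ofReal (key t ht s hs)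

/-! ### Borel–Cantelli and continuous modifications from tail bounds -/

lemma ae_eventually_notMem_of_measureReal_le_geometric {Ω : Type*} [MeasurableSpace Ω]
    {P : Measure Ω} [IsFiniteMeasure P] {E : ℕ → Set Ω} {C q : ℝ} (hq0 : 0 ≤ q)
    (hq1 : q < 1) (h : ∀ n, P.real (E n) ≤ C * q ^ n) :
    ∀ᵐ ω ∂P, ∀ᶠ n in atTop, ω ∉ E n := by
  refine ae_eventually_notMem ?_
  have hs : Summable fun n => C * q ^ n := (summable_geometric_of_lt_one hq0 hq1).mul_left C
  refine ne_top_of_le_ne_top hs.tsum_ofReal_ne_top (ENNReal.tsum_le_tsum fun n => ?_)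
  rw [← ofReal_measureReal]
  exact ENNReal.ofReal_le_ofReal (h n)

section Tail

variable {Ω : Type*} [MeasurableSpace Ω] {P : Measure Ω}
  {X : ℝ → Ω → ℝ} {a H C β : ℝ}

lemma measureReal_abs_sub_dyadic_le (ha : 0 < a) (hH : 0 < H) (hC : 0 ≤ C)
    (hX : ∀ s t y, 0 < y → P.real {ω | y < |X t ω - X s ω|} ≤ C * (|t - s| ^ H / y) ^ a)
    {s t : ℝ} {n : ℕ} (hst : |t - s| ≤ 1 / 2 ^ n) :
    P.real {ω | ((2 : ℝ) ^ (-β)) ^ n < |X t ω - X s ω|}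
      ≤ C * ((2 : ℝ) ^ (-((H - β) * a))) ^ n := by
  refine (hX s t _ (by positivity)).trans (mul_le_mul_of_nonneg_left ?_ hC)
  have h1 : |t - s| ^ H ≤ ((2 : ℝ) ^ (-H)) ^ n := by
    refine (Real.rpow_le_rpow (abs_nonneg _) hst hH.le).trans_eq ?_
    rw [one_div, ← Real.rpow_natCast, ← Real.rpow_natCast, ← Real.rpow_neg (by norm_num),
      ← Real.rpow_mul (by norm_num), ← Real.rpow_mul (by norm_num)]
    ring_nf
  calc (|t - s| ^ H / ((2 : ℝ) ^ (-β)) ^ n) ^ a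
      ≤ (((2 : ℝ) ^ (-H)) ^ n / ((2 : ℝ) ^ (-β)) ^ n) ^ a := by gcongr
    _ = _ := by
      rw [← div_pow, ← Real.rpow_sub (by norm_num), ← Real.rpow_natCast, ← Real.rpow_natCast,
        ← Real.rpow_mul (by positivity), ← Real.rpow_mul (by positivity),
        ← Real.rpow_mul (by positivity)]
      ring_nf

lemma ae_dyadicHolder [IsFiniteMeasure P] (ha : 0 < a) (hH : 0 < H) (hC : 0 ≤ C)
    (hβ : β < H - 1 / a)
    (hX : ∀ s t y, 0 < y → P.real {ω | y < |X t ω - X s ω|} ≤ C * (|t - s| ^ H / y) ^ a) :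
    ∀ᵐ ω ∂P, DyadicHolder β fun t => X t ω := by
  unfold DyadicHolder
  rw [ae_all_iff]
  intro K
  set E : ℕ → Set Ω := fun n => ⋃ k ∈ Finset.Icc (-((K : ℤ) * 2 ^ n)) ((K : ℤ) * 2 ^ n),
    {ω | ((2 : ℝ) ^ (-β)) ^ n < |X (((k : ℤ) + 1) / 2 ^ n) ω - X (k / 2 ^ n) ω|} with hE
  -- The ratio per level: twice as many grid points, each with probability smaller by `2 ^ (-((H -
  -- β) * a))`.
  set q : ℝ := (2 : ℝ) ^ (1 - (H - β) * a) with hq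
  have hq1 : q < 1 := by
    refine Real.rpow_lt_one_of_one_lt_of_neg one_lt_two ?_
    have : 1 / a * a < (H - β) * a := mul_lt_mul_of_pos_right (by linarith) ha
    rw [one_div_mul_cancel ha.ne'] at this
    linarith
  have hPE : ∀ n, P.real (E n) ≤ ((2 * K + 1) * C) * q ^ n := by
    intro n
    have hq' : q ^ n = 2 ^ n * ((2 : ℝ) ^ (-((H - β) * a))) ^ n := by
      rw [hq, sub_eq_add_neg, Real.rpow_add (by norm_num), Real.rpow_one, mul_pow]
    refine (measureReal_biUnion_finset_le _ _).trans ((Finset.sum_le_card_nsmul _ _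
      (C * ((2 : ℝ) ^ (-((H - β) * a))) ^ n) fun k _ =>
        measureReal_abs_sub_dyadic_le ha hH hC hX ?_).trans ?_)
    · rw [← sub_div, add_sub_cancel_left, abs_of_nonneg (by positivity)]
    · have h2 : (1 : ℝ) ≤ 2 ^ n := one_le_pow₀ one_le_two
      have hcard : ((Finset.Icc (-((K : ℤ) * 2 ^ n)) ((K : ℤ) * 2 ^ n)).card : ℝ)
          = 2 * K * 2 ^ n + 1 := by
        rw [Int.card_Icc]
        have h0 : (0 : ℤ) ≤ K * 2 ^ n + 1 - -(K * 2 ^ n) := by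
          have : (0 : ℤ) ≤ K * 2 ^ n := by positivity
          linarith
        have h1 := congrArg (fun z : ℤ => (z : ℝ)) (Int.toNat_of_nonneg h0)
        push_cast at h1
        rw [h1]
        ring
      rw [nsmul_eq_mul, hcard, hq']
      have hpos : 0 ≤ C * ((2 : ℝ) ^ (-((H - β) * a))) ^ n := by positivity
      calc (2 * K * 2 ^ n + 1) * (C * ((2 : ℝ) ^ (-((H - β) * a))) ^ n)
          ≤ ((2 * K + 1) * 2 ^ n) * (C * ((2 : ℝ) ^ (-((H - β) * a))) ^ n) := by
            refine mul_le_mul_of_nonneg_right ?_ hpos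
            linarith
        _ = _ := by ring
  filter_upwards [ae_eventually_notMem_of_measureReal_le_geometric (by positivity) hq1 hPE]
    with ω hω
  filter_upwards [hω] with n hn k hk
  by_contra hlt
  refine hn (Set.mem_biUnion (x := k) ?_ (not_le.1 hlt))
  rw [Finset.mem_coe, Finset.mem_Icc]
  exact_mod_cast abs_le.1 hk

/-- For a fixed `t` there is one increment per level and no union bound, so `β < H` is enough. -/
lemma ae_tendsto_dyadicFloor [IsFiniteMeasure P] (ha : 0 < a) (hH : 0 < H) (hC : 0 ≤ C)
    (hβ0 : 0 < β) (hβ : β < H)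
    (hX : ∀ s t y, 0 < y → P.real {ω | y < |X t ω - X s ω|} ≤ C * (|t - s| ^ H / y) ^ a)
    (t : ℝ) :
    ∀ᵐ ω ∂P, Tendsto (fun n => X (dyadicFloor n t) ω) atTop (𝓝 (X t ω)) := by
  have hq1 : (2 : ℝ) ^ (-((H - β) * a)) < 1 :=
    two_rpow_neg_lt_one (mul_pos (sub_pos.2 hβ) ha)
  filter_upwards [ae_eventually_notMem_of_measureReal_le_geometric (P := P) (by positivity) hq1
    fun n => measureReal_abs_sub_dyadic_le (β := β) ha hH hC hX (abs_sub_dyadicFloor_le n t)]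
    with ω hω
  rw [tendsto_iff_dist_tendsto_zero]
  refine squeeze_zero' (Eventually.of_forall fun n => dist_nonneg) ?_
    (tendsto_pow_atTop_nhds_zero_of_lt_one (r := (2 : ℝ) ^ (-β)) (by positivity)
      (two_rpow_neg_lt_one hβ0))
  filter_upwards [hω] with n hn
  rw [dist_comm, Real.dist_eq]
  exact not_lt.1 hn

/-- A Kolmogorov–Chentsov theorem under a bound on the tails of the increments. -/
theorem exists_continuous_modification_of_tail_le [IsFiniteMeasure P] (ha : 0 < a) (hC : 0 ≤ C)
    (hHa : 0 < H - 1 / a) (hXm : ∀ t, Measurable (X t))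
    (hX : ∀ s t y, 0 < y → P.real {ω | y < |X t ω - X s ω|} ≤ C * (|t - s| ^ H / y) ^ a) :
    ∃ Y : ℝ → Ω → ℝ,
      (∀ t, Measurable (Y t)) ∧
      (∀ t, ∀ᵐ ω ∂P, Y t ω = X t ω) ∧
      (∀ ω, Continuous fun t => Y t ω) ∧
      ∀ β : ℝ≥0, 0 < β → (β : ℝ) < H - 1 / a →
        ∀ᵐ ω ∂P, ∀ c d : ℝ, ∃ C : ℝ≥0,
          HolderOnWith C β (fun t => Y t ω) (Set.Icc c d) := by
  have ha' : 0 < 1 / a := by positivity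
  have hH : 0 < H := by linarith
  obtain ⟨β₀, hβ₀, hβ₀'⟩ := exists_between hHa
  have hgood := ae_dyadicHolder ha hH hC hβ₀' hX
  -- Setting the process to zero off a measurable set of good paths makes every path continuous and
  -- keeps `Y t` measurable.
  obtain ⟨S, hSgood, hSm, hS⟩ := hgood.exists_measurable_mem
  set Z : ℝ → Ω → ℝ := fun t => S.indicator (X t) with hZ
  have hZeq : ∀ ω ∈ S, ∀ t, Z t ω = X t ω := fun ω hω t => Set.indicator_of_mem hω _
  have hZholder : ∀ ω, DyadicHolder β₀ fun t => Z t ω := by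
    intro ω
    by_cases hω : ω ∈ S
    · simpa only [hZeq ω hω] using hS ω hω
    · intro K
      refine Eventually.of_forall fun n k _ => ?_
      simp only [hZ, Set.indicator_of_notMem hω, sub_self, abs_zero]
      positivity
  choose Y hY using fun t ω => (hZholder ω).exists_tendsto hβ₀ t
  have hSae : ∀ᵐ ω ∂P, ω ∈ S := hSgood
  refine ⟨Y, fun t => ?_, fun t => ?_, fun ω => ?_, fun β hβ hβ' => ?_⟩
  · exact measurable_of_tendsto_metrizable
      (f := fun n => Z (dyadicFloor n t)) (fun n => (hXm _).indicator hSm)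
      (tendsto_pi_nhds.2 fun ω => hY t ω)
  · filter_upwards [hSae, ae_tendsto_dyadicFloor ha hH hC hβ₀ (by linarith) hX t] with ω hω hlim
    refine tendsto_nhds_unique (hY t ω) ?_
    simpa only [hZeq ω hω] using hlim
  · exact (hZholder ω).continuous_limit hβ₀ fun t => hY t ω
  -- `Y` was built with `β₀`, but it is the dyadic limit of `X` on `S`, so the dyadic bound for any
  -- other `β` transfers to the same `Y`.
  · filter_upwards [hSae, ae_dyadicHolder ha hH hC hβ' hX] with ω hω hlim c d
    refine hlim.exists_holderOnWith_limit hβ (fun t => ?_) c d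
    simpa only [hZeq ω hω] using hY t ω

end Tail

/-! ### Increments of tempered powers -/

/-- The function `e^{-λ y_+} y_+ ^ γ`. -/
noncomputable def temperedPow (lam γ y : ℝ) : ℝ := Real.exp (-lam * max y 0) * posPow y γ

lemma kernel_sub_kernel (H : ℝ) (α : ℝ → ℝ) (lam s t x : ℝ) :
    kernel H α lam t x - kernel H α lam s x
      = temperedPow lam (H - 1 / α x) (t - x) - temperedPow lam (H - 1 / α x) (s - x) := by
  simp only [kernel, temperedPow]
  ring

lemma kernel_zero (H : ℝ) (α : ℝ → ℝ) (lam x : ℝ) : kernel H α lam 0 x = 0 := by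
  simp [kernel]

lemma temperedPow_of_nonpos {lam γ y : ℝ} (hy : y ≤ 0) : temperedPow lam γ y = 0 := by
  simp [temperedPow, posPow, not_lt.2 hy]

lemma temperedPow_of_pos {lam γ y : ℝ} (hy : 0 < y) :
    temperedPow lam γ y = Real.exp (-lam * y) * y ^ γ := by
  simp [temperedPow, posPow, hy, hy.le]

lemma temperedPow_nonneg (lam γ y : ℝ) : 0 ≤ temperedPow lam γ y := by
  rcases le_or_gt y 0 with hy | hy
  · rw [temperedPow_of_nonpos hy]
  · rw [temperedPow_of_pos hy]
    positivity

lemma temperedPow_le {lam γ y z : ℝ} (hlam : 0 ≤ lam) (hγ : 0 ≤ γ) (hz : 0 ≤ z) (hy : y ≤ z) :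
    temperedPow lam γ y ≤ z ^ γ := by
  rcases le_or_gt y 0 with hy0 | hy0
  · rw [temperedPow_of_nonpos hy0]
    positivity
  · rw [temperedPow_of_pos hy0]
    have h1 : Real.exp (-lam * y) ≤ 1 := Real.exp_le_one_iff.2 (by nlinarith)
    calc Real.exp (-lam * y) * y ^ γ ≤ 1 * z ^ γ := by gcongr
      _ = z ^ γ := one_mul _

/-- Mean value inequality: the derivative is `e^{-λy} (γ - λy) y ^ (γ - 1)`, and `λy e^{-λy} ≤ 1`
makes the bound independent of `λ`. -/
lemma abs_temperedPow_add_sub_le {lam γ u h : ℝ} (hlam : 0 ≤ lam) (hγ0 : 0 ≤ γ) (hγ1 : γ ≤ 1)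
    (hu : 0 < u) (hh : 0 ≤ h) :
    |temperedPow lam γ (u + h) - temperedPow lam γ u| ≤ 2 * h * u ^ (γ - 1) := by
  rw [temperedPow_of_pos hu, temperedPow_of_pos (by linarith : 0 < u + h)]
  have key : ∀ y ∈ Set.Icc u (u + h),
      HasDerivWithinAt (fun y => Real.exp (-lam * y) * y ^ γ)
        (Real.exp (-lam * y) * -lam * y ^ γ + Real.exp (-lam * y) * (γ * y ^ (γ - 1)))
        (Set.Icc u (u + h)) y := by
    intro y hy
    have hy0 : 0 < y := hu.trans_le hy.1
    refine HasDerivAt.hasDerivWithinAt ?_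
    refine HasDerivAt.mul ?_ (Real.hasDerivAt_rpow_const (Or.inl hy0.ne'))
    simpa using ((hasDerivAt_id y).const_mul (-lam)).exp
  have bound : ∀ y ∈ Set.Icc u (u + h),
      ‖Real.exp (-lam * y) * -lam * y ^ γ + Real.exp (-lam * y) * (γ * y ^ (γ - 1))‖
        ≤ 2 * u ^ (γ - 1) := by
    intro y hy
    have hy0 : 0 < y := hu.trans_le hy.1
    have h1 : Real.exp (-lam * y) ≤ 1 := Real.exp_le_one_iff.2 (by nlinarith)
    have h2 : lam * y * Real.exp (-lam * y) ≤ 1 := by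
      rw [neg_mul, Real.exp_neg, ← div_eq_mul_inv, div_le_one (Real.exp_pos _)]
      linarith [Real.add_one_le_exp (lam * y)]
    have h3 : y ^ γ = y * y ^ (γ - 1) := by
      rw [Real.rpow_sub_one hy0.ne']
      field_simp
    have h4 : y ^ (γ - 1) ≤ u ^ (γ - 1) :=
      Real.rpow_le_rpow_of_nonpos hu hy.1 (by linarith)
    have h5 : 0 ≤ y ^ (γ - 1) := by positivity
    have h6 : 0 ≤ lam * y * Real.exp (-lam * y) := by positivity
    have h7 : 0 ≤ Real.exp (-lam * y) * γ := by positivity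
    have h8 : Real.exp (-lam * y) * γ ≤ 1 := mul_le_one₀ h1 hγ0 hγ1
    have h9 : Real.exp (-lam * y) * -lam * y ^ γ + Real.exp (-lam * y) * (γ * y ^ (γ - 1))
        = (Real.exp (-lam * y) * γ - lam * y * Real.exp (-lam * y)) * y ^ (γ - 1) := by
      rw [h3]
      ring
    rw [h9, norm_mul, Real.norm_of_nonneg h5, Real.norm_eq_abs]
    refine mul_le_mul ?_ h4 h5 (by norm_num)
    rw [abs_le]
    constructor <;> linarith
  have := (convex_Icc u (u + h)).norm_image_sub_le_of_norm_hasDerivWithin_le key bound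
    (Set.left_mem_Icc.2 (by linarith)) (Set.right_mem_Icc.2 (by linarith))
  rw [add_sub_cancel_left, Real.norm_of_nonneg hh, Real.norm_eq_abs] at this
  linarith

/-- The majorant of `|(g (u + h) - g u) / h ^ H| ^ α` for tempered powers `g` of exponent
`H - 1 / α`. -/
noncomputable def incrementMajorant (c h u : ℝ) : ℝ :=
  (Set.Ioc (-h) h).indicator (fun _ => 4 / h) u
    + (Set.Ioi h).indicator (fun u => 4 * h ^ c * u ^ (-c - 1)) u

lemma incrementMajorant_nonneg {c h : ℝ} (hh : 0 < h) (u : ℝ) : 0 ≤ incrementMajorant c h u := by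
  refine add_nonneg (Set.indicator_nonneg (fun _ _ => by positivity) _)
    (Set.indicator_nonneg (fun u hu => ?_) _)
  have : 0 < u := hh.trans hu
  positivity

lemma integrable_incrementMajorant {c h : ℝ} (hc : 0 < c) (hh : 0 < h) :
    Integrable (incrementMajorant c h) := by
  refine Integrable.add ?_ ?_
  · exact (integrable_indicator_iff measurableSet_Ioc).2 (integrableOn_const (by simp))
  · exact (integrable_indicator_iff measurableSet_Ioi).2
      ((integrableOn_Ioi_rpow_of_lt (by linarith) hh).const_mul _)

/-- The value is free of `h` by scaling, so `|t - s| ^ H` is the right normalization whatever the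
exponent `α x`. -/
lemma integral_incrementMajorant {c h : ℝ} (hc : 0 < c) (hh : 0 < h) :
    ∫ u, incrementMajorant c h u = 8 + 4 / c := by
  unfold incrementMajorant
  rw [integral_add ((integrable_indicator_iff measurableSet_Ioc).2 (integrableOn_const (by simp)))
    ((integrable_indicator_iff measurableSet_Ioi).2
      ((integrableOn_Ioi_rpow_of_lt (by linarith) hh).const_mul _)),
    integral_indicator measurableSet_Ioc, integral_indicator measurableSet_Ioi,
    integral_const_mul, integral_Ioi_rpow_of_lt (by linarith) hh, setIntegral_const,
    Real.volume_real_Ioc_of_le (by linarith)]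
  have h1 : -c - 1 + 1 = -c := by ring
  rw [h1, Real.rpow_neg hh.le]
  have h2 : 0 < h ^ c := by positivity
  simp only [smul_eq_mul]
  field_simp
  ring

/-- For `|u| ≤ h` both values lie in `[0, 2 h ^ γ]`, and `γ p = H p - 1` leaves `2 ^ p / h`. For `u
> h` the derivative bound gives `(h / u) ^ (p (1 - H)) / u`, largest at `p = a` because `h / u < 1`.
The hypothesis `1 ≤ H * a` ensures `γ ≥ 0`. -/
lemma temperedPow_increment_le {lam H a p h : ℝ} (hlam : 0 ≤ lam) (ha : 0 < a)
    (hH1 : H < 1) (hHa : 1 ≤ H * a) (hap : a ≤ p) (hp : p ≤ 2) (hh : 0 < h) (u : ℝ) :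
    |(temperedPow lam (H - 1 / p) (u + h) - temperedPow lam (H - 1 / p) u) / h ^ H| ^ p
      ≤ incrementMajorant (a * (1 - H)) h u := by
  have hp0 : 0 < p := ha.trans_le hap
  set γ := H - 1 / p with hγ
  have hγp : γ * p = H * p - 1 := by
    rw [hγ]
    field_simp
  have hH0 : 0 < H := pos_of_mul_pos_left (one_pos.trans_le hHa) ha.le
  have hγ0 : 0 ≤ γ := by
    rw [hγ, sub_nonneg, div_le_iff₀ hp0]
    exact hHa.trans (mul_le_mul_of_nonneg_left hap hH0.le)
  have hγ1 : γ ≤ 1 := by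
    have : 0 < 1 / p := by positivity
    linarith
  have h4 : (2 : ℝ) ^ p ≤ 4 := by
    refine (Real.rpow_le_rpow_of_exponent_le one_le_two hp).trans_eq ?_
    norm_num
  have hhH : 0 < h ^ H := by positivity
  rcases le_or_gt u (-h) with hu | hu
  · rw [temperedPow_of_nonpos (by linarith), temperedPow_of_nonpos (by linarith), sub_zero,
      zero_div, abs_zero, Real.zero_rpow hp0.ne']
    exact incrementMajorant_nonneg hh u
  rcases le_or_gt u h with hu' | hu'
  · rw [incrementMajorant, Set.indicator_of_mem (Set.mem_Ioc.2 ⟨hu, hu'⟩),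
      Set.indicator_of_notMem (by simpa using hu'), add_zero]
    have h1 : |temperedPow lam γ (u + h) - temperedPow lam γ u| ≤ 2 * h ^ γ := by
      refine (abs_sub_le_of_nonneg_of_le (temperedPow_nonneg _ _ _)
        (temperedPow_le hlam hγ0 (by linarith) (by linarith : u + h ≤ 2 * h))
        (temperedPow_nonneg _ _ _)
        (temperedPow_le hlam hγ0 (by linarith) (by linarith : u ≤ 2 * h))).trans ?_
      rw [Real.mul_rpow (by norm_num) hh.le]
      refine mul_le_mul_of_nonneg_right ?_ (by positivity)
      exact (Real.rpow_le_rpow_of_exponent_le one_le_two hγ1).trans_eq (Real.rpow_one 2)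
    rw [abs_div, abs_of_pos hhH]
    calc (|temperedPow lam γ (u + h) - temperedPow lam γ u| / h ^ H) ^ p
        ≤ (2 * h ^ γ / h ^ H) ^ p := by gcongr
      _ = 2 ^ p * h⁻¹ := by
        rw [mul_div_assoc, Real.mul_rpow (by norm_num) (by positivity), ← Real.rpow_sub hh,
          ← Real.rpow_mul hh.le, sub_mul, hγp, ← Real.rpow_neg_one]
        ring_nf
      _ ≤ 4 * h⁻¹ := by gcongr
      _ = 4 / h := (div_eq_mul_inv _ _).symm
  · have hu0 : 0 < u := hh.trans hu'
    rw [incrementMajorant, Set.indicator_of_notMem (by simp [hu']),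
      Set.indicator_of_mem (Set.mem_Ioi.2 hu'), zero_add]
    have h1 := abs_temperedPow_add_sub_le hlam hγ0 hγ1 hu0 hh.le
    rw [abs_div, abs_of_pos hhH]
    calc (|temperedPow lam γ (u + h) - temperedPow lam γ u| / h ^ H) ^ p
        ≤ (2 * h * u ^ (γ - 1) / h ^ H) ^ p := by gcongr
      _ = (2 * (h ^ (1 - H) * u ^ (γ - 1))) ^ p := by
        rw [Real.rpow_sub hh, Real.rpow_one]
        ring_nf
      _ = 2 ^ p * ((h / u) ^ (p * (1 - H)) * u⁻¹) := by
        rw [Real.mul_rpow (by norm_num) (by positivity), Real.mul_rpow (by positivity)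
          (by positivity), ← Real.rpow_mul hh.le, ← Real.rpow_mul hu0.le,
          Real.div_rpow hh.le hu0.le, sub_mul γ, hγp, ← Real.rpow_neg_one u, div_eq_mul_inv,
          ← Real.rpow_neg hu0.le, mul_assoc (h ^ _), ← Real.rpow_add hu0]
        ring_nf
      _ ≤ 4 * ((h / u) ^ (a * (1 - H)) * u⁻¹) := by
        have h2 : (h / u) ^ (p * (1 - H)) ≤ (h / u) ^ (a * (1 - H)) :=
          Real.rpow_le_rpow_of_exponent_ge (by positivity) ((div_le_one hu0).2 hu'.le)
            (mul_le_mul_of_nonneg_right hap (by linarith))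
        gcongr
      _ = 4 * h ^ (a * (1 - H)) * u ^ (-(a * (1 - H)) - 1) := by
        rw [Real.div_rpow hh.le hu0.le, Real.rpow_sub_one hu0.ne', Real.rpow_neg hu0.le]
        ring

/-! ### Kernel increments and the tail bound -/

lemma aemeasurable_kernel {α : ℝ → ℝ} (hα : AEMeasurable α volume) (H lam t : ℝ) :
    AEMeasurable (kernel H α lam t) volume := by
  have hpow : ∀ s : ℝ, AEMeasurable (fun x => posPow (s - x) (H - 1 / α x)) volume := by
    intro s
    have h : Measurable fun p : ℝ × ℝ => posPow p.1 p.2 :=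
      Measurable.ite (measurableSet_lt measurable_const measurable_fst)
        (measurable_fst.pow measurable_snd) measurable_const
    exact h.comp_aemeasurable ((by fun_prop : AEMeasurable (fun x : ℝ => s - x) volume).prodMk
      (by fun_prop : AEMeasurable (fun x => H - 1 / α x) volume))
  have h0 := hpow 0
  simp only [zero_sub] at h0
  unfold kernel
  exact ((by fun_prop : AEMeasurable (fun x => Real.exp (-lam * max (t - x) 0)) volume).mul
    (hpow t)).sub
      ((by fun_prop : AEMeasurable (fun x : ℝ => Real.exp (-lam * max (-x) 0)) volume).mul h0)

section Increments

variable {a H lam : ℝ} {α : ℝ → ℝ}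

lemma exists_kernel_increment_majorant (ha : 0 < a) (hH1 : H < 1) (hlam : 0 ≤ lam)
    (hHa : 1 ≤ H * a) (hα : ∀ x, α x ∈ Set.Icc a 2) {s t : ℝ} (hst : t ≠ s) :
    ∃ D : ℝ → ℝ, Integrable D ∧ ∫ x, D x = 8 + 4 / (a * (1 - H)) ∧
      ∀ x, |(kernel H α lam t x - kernel H α lam s x) / |t - s| ^ H| ^ α x ≤ D x := by
  have main : ∀ s t : ℝ, s < t → ∃ D : ℝ → ℝ, Integrable D ∧
      ∫ x, D x = 8 + 4 / (a * (1 - H)) ∧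
      ∀ x, |(kernel H α lam t x - kernel H α lam s x) / |t - s| ^ H| ^ α x ≤ D x := by
    intro s t hst
    have hc : 0 < a * (1 - H) := mul_pos ha (sub_pos.2 hH1)
    have hh : 0 < t - s := sub_pos.2 hst
    refine ⟨fun x => incrementMajorant (a * (1 - H)) (t - s) (s - x),
      (integrable_incrementMajorant hc hh).comp_sub_left s, ?_, fun x => ?_⟩
    · rw [integral_sub_left_eq_self (incrementMajorant (a * (1 - H)) (t - s)),
        integral_incrementMajorant hc hh]
    · have := temperedPow_increment_le hlam ha hH1 hHa (hα x).1 (hα x).2 hh (s - x)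
      rw [abs_of_pos hh]
      rwa [show s - x + (t - s) = t - x by ring, ← kernel_sub_kernel] at this
  rcases hst.lt_or_gt with h | h
  · obtain ⟨D, hD1, hD2, hD3⟩ := main t s h
    refine ⟨D, hD1, hD2, fun x => ?_⟩
    have := hD3 x
    rwa [abs_sub_comm s t, ← neg_sub (kernel H α lam t x), neg_div, abs_neg] at this
  · exact main s t h

lemma eight_le_majorant_const (ha : 0 < a) (hH1 : H < 1) : 8 ≤ 8 + 4 / (a * (1 - H)) := by
  have : 0 < 1 - H := sub_pos.2 hH1
  have : 0 < 4 / (a * (1 - H)) := by positivity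
  linarith

/-- The kernel vanishes at time `0`, so it is itself an increment. Dividing further by `C ≥ 1`, the
integral of the majorant, brings the integral below `1`, since `C ^ α x ≥ C` for `α x ≥ 1`. -/
lemma memF_kernel (ha : 1 ≤ a) (hH1 : H < 1) (hlam : 0 ≤ lam) (hHa : 1 ≤ H * a)
    (hαm : AEMeasurable α volume) (hα : ∀ x, α x ∈ Set.Icc a 2) (t : ℝ) :
    MemF α (kernel H α lam t) := by
  have ha0 : 0 < a := one_pos.trans_le ha
  refine ⟨aemeasurable_kernel hαm H lam t, ?_⟩
  suffices h : ∃ r : ℝ, 0 < r ∧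
      ∫⁻ x, ENNReal.ofReal (|kernel H α lam t x / r| ^ α x) ≤ 1 by
    obtain ⟨r, hr, hr'⟩ := h
    exact (iInf_le_of_le r (iInf_le_of_le hr (iInf_le _ hr'))).trans_lt ENNReal.ofReal_lt_top
  rcases eq_or_ne t 0 with rfl | ht
  · refine ⟨1, one_pos, ?_⟩
    have h : ∀ x, (0 : ℝ) ^ α x = 0 := fun x => Real.zero_rpow (ha0.trans_le (hα x).1).ne'
    simp [kernel_zero, h]
  · obtain ⟨D, hD1, hD2, hD3⟩ := exists_kernel_increment_majorant ha0 hH1 hlam hHa hα ht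
    set C := 8 + 4 / (a * (1 - H)) with hC
    have hC8 : 8 ≤ C := eight_le_majorant_const ha0 hH1
    have hC0 : 0 < C := by linarith
    simp only [kernel_zero, sub_zero] at hD3
    have hpos : 0 < |t| ^ H := Real.rpow_pos_of_pos (abs_pos.2 ht) H
    have hD0 : ∀ x, 0 ≤ D x := fun x => le_trans (by positivity) (hD3 x)
    refine ⟨|t| ^ H * C, by positivity, ?_⟩
    calc ∫⁻ x, ENNReal.ofReal (|kernel H α lam t x / (|t| ^ H * C)| ^ α x)
        ≤ ∫⁻ x, ENNReal.ofReal (D x * C⁻¹) := by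
          refine lintegral_mono fun x => ENNReal.ofReal_le_ofReal ?_
          rw [← div_div, abs_div, abs_of_pos hC0, Real.div_rpow (abs_nonneg _) hC0.le,
            div_eq_mul_inv]
          refine mul_le_mul (hD3 x) ?_ (by positivity) (hD0 x)
          refine inv_anti₀ hC0 ?_
          refine (Real.rpow_one C).symm.trans_le
            (Real.rpow_le_rpow_of_exponent_le (by linarith) (ha.trans (hα x).1))
      _ = ENNReal.ofReal (∫ x, D x * C⁻¹) :=
          (ofReal_integral_eq_lintegral_ofReal (hD1.mul_const _)
            (ae_of_all _ fun x => mul_nonneg (hD0 x) (inv_nonneg.2 hC0.le))).symm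
      _ ≤ 1 := by
          rw [integral_mul_const, hD2, mul_inv_cancel₀ hC0.ne', ENNReal.ofReal_one]

lemma integral_kernel_increment_le (ha : 0 < a) (hH1 : H < 1) (hlam : 0 ≤ lam)
    (hHa : 1 ≤ H * a) (hα : ∀ x, α x ∈ Set.Icc a 2) {s t θ : ℝ}
    (hθ : |θ| * |t - s| ^ H ≤ 1) :
    ∫ x, |θ * (kernel H α lam t x - kernel H α lam s x)| ^ α x
      ≤ (8 + 4 / (a * (1 - H))) * (|θ| * |t - s| ^ H) ^ a := by
  have hC8 : 8 ≤ 8 + 4 / (a * (1 - H)) := eight_le_majorant_const ha hH1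
  rcases eq_or_ne t s with rfl | hst
  · have h : ∀ x, (0 : ℝ) ^ α x = 0 := fun x => Real.zero_rpow (ha.trans_le (hα x).1).ne'
    simp only [sub_self, mul_zero, abs_zero, h, integral_zero]
    positivity
  · obtain ⟨D, hD1, hD2, hD3⟩ := exists_kernel_increment_majorant ha hH1 hlam hHa hα hst
    have hpos : 0 < |t - s| ^ H := Real.rpow_pos_of_pos (abs_pos.2 (sub_ne_zero.2 hst)) H
    have hbound : ∀ x, |θ * (kernel H α lam t x - kernel H α lam s x)| ^ α x
        ≤ D x * (|θ| * |t - s| ^ H) ^ a := by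
      intro x
      have h1 : |θ * (kernel H α lam t x - kernel H α lam s x)|
          = |(kernel H α lam t x - kernel H α lam s x) / |t - s| ^ H|
            * (|θ| * |t - s| ^ H) := by
        rw [abs_mul, abs_div, abs_of_pos hpos]
        field_simp
      rw [h1, Real.mul_rpow (abs_nonneg _) (by positivity)]
      refine mul_le_mul (hD3 x) ?_ (by positivity) (le_trans (by positivity) (hD3 x))
      -- The base may be `0` when `θ = 0`; the side condition holds because `α x ≠ 0`.
      exact Real.rpow_le_rpow_of_exponent_ge_of_imp (by positivity) hθ (hα x).1
        fun _ h => absurd h (ha.trans_le (hα x).1).ne'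
    calc ∫ x, |θ * (kernel H α lam t x - kernel H α lam s x)| ^ α x
        ≤ ∫ x, D x * (|θ| * |t - s| ^ H) ^ a :=
          integral_mono_of_nonneg (ae_of_all _ fun x => by positivity) (hD1.mul_const _)
            (ae_of_all _ hbound)
      _ = _ := by rw [integral_mul_const, hD2]

variable {Ω : Type*} [MeasurableSpace Ω] {P : Measure Ω} {X : ℝ → Ω → ℝ}

lemma IsLTFmSM.charFun_increment (hX : IsLTFmSM P H α lam X)
    (hF : ∀ t, MemF α (kernel H α lam t)) (s t θ : ℝ) :
    charFun (P.map fun ω => X t ω - X s ω) θ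
      = Complex.exp (-((∫ x, |θ * (kernel H α lam t x - kernel H α lam s x)| ^ α x : ℝ) : ℂ)) := by
  have hm : Measurable fun ω => X t ω - X s ω := (hX.measurable t).sub (hX.measurable s)
  rw [charFun_apply_real, integral_map hm.aemeasurable (by fun_prop)]
  have h := hX.charFun_eq 2 ![t, s] ![θ, -θ] fun k => hF _
  simp only [Fin.sum_univ_two, Matrix.cons_val_zero, Matrix.cons_val_one, neg_mul,
    ← sub_eq_add_neg, ← mul_sub] at h
  rw [← h]
  refine integral_congr_ae (ae_of_all _ fun ω => ?_)
  simp only [Complex.ofReal_mul]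
  rw [mul_comm Complex.I]

lemma IsLTFmSM.measureReal_increment_le [IsProbabilityMeasure P]
    (hX : IsLTFmSM P H α lam X) (ha : 1 ≤ a) (hH1 : H < 1) (hlam : 0 ≤ lam)
    (hHa : 1 ≤ H * a) (hαm : AEMeasurable α volume) (hα : ∀ x, α x ∈ Set.Icc a 2)
    (s t : ℝ) {y : ℝ} (hy : 0 < y) :
    P.real {ω | y < |X t ω - X s ω|}
      ≤ 8 * (8 + 4 / (a * (1 - H))) * (|t - s| ^ H / y) ^ a := by
  have ha0 : 0 < a := one_pos.trans_le ha
  have ha2 : a ≤ 2 := (hα 0).1.trans (hα 0).2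
  have hC8 : 8 ≤ 8 + 4 / (a * (1 - H)) := eight_le_majorant_const ha0 hH1
  set C := 8 + 4 / (a * (1 - H)) with hC
  set r := |t - s| ^ H with hr
  have hr0 : 0 ≤ r := by positivity
  -- For `y < 2 * r` the claimed bound exceeds `1`. Otherwise `|θ| * r ≤ 1` on the whole range `|θ|
  -- ≤ 2 / y`.
  rcases lt_or_ge y (2 * r) with hyr | hyr
  · have h1 : (1 / 4 : ℝ) ≤ (r / y) ^ a := by
      calc (1 / 4 : ℝ) = (1 / 2 : ℝ) ^ (2 : ℝ) := by norm_num
        _ ≤ (1 / 2 : ℝ) ^ a :=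
          Real.rpow_le_rpow_of_exponent_ge (by norm_num) (by norm_num) ha2
        _ ≤ (r / y) ^ a := by
          refine Real.rpow_le_rpow (by norm_num) ?_ ha0.le
          rw [le_div_iff₀ hy]
          linarith
    exact measureReal_le_one.trans (by nlinarith)
  · have hm : Measurable fun ω => X t ω - X s ω := (hX.measurable t).sub (hX.measurable s)
    have hprob : IsProbabilityMeasure (P.map fun ω => X t ω - X s ω) :=
      Measure.isProbabilityMeasure_map hm.aemeasurable
    have h1 := measureReal_abs_gt_le_integral_charFun
      (μ := P.map fun ω => X t ω - X s ω) hy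
    rw [map_measureReal_apply hm (measurableSet_lt measurable_const (by fun_prop))] at h1
    have hbound : ∀ θ ∈ Set.uIoc (-2 * y⁻¹) (2 * y⁻¹),
        ‖1 - charFun (P.map fun ω => X t ω - X s ω) θ‖ ≤ C * (2 * (r / y)) ^ a := by
      intro θ hθ
      rw [Set.uIoc_of_le (by have := inv_pos.2 hy; linarith)] at hθ
      have hθ' : |θ| ≤ 2 * y⁻¹ := abs_le.2 ⟨by linarith [hθ.1], hθ.2⟩
      have hθr : |θ| * r ≤ 2 * (r / y) :=
        (mul_le_mul_of_nonneg_right hθ' hr0).trans_eq (by ring)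
      have hry : 2 * (r / y) ≤ 1 := by
        rw [← mul_div_assoc]
        exact (div_le_one hy).2 hyr
      have hJ := integral_kernel_increment_le (lam := lam) ha0 hH1 hlam hHa hα (hθr.trans hry)
      rw [hX.charFun_increment (memF_kernel ha hH1 hlam hHa hαm hα)]
      set J := ∫ x, |θ * (kernel H α lam t x - kernel H α lam s x)| ^ α x with hJdef
      have hJ0 : 0 ≤ J := integral_nonneg fun x => by positivity
      have h2 : (1 : ℂ) - Complex.exp (-(J : ℂ)) = ((1 - Real.exp (-J) : ℝ) : ℂ) := by
        push_cast
        rfl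
      rw [h2, Complex.norm_real, Real.norm_of_nonneg
        (sub_nonneg.2 (Real.exp_le_one_iff.2 (by linarith)))]
      have h3 : 1 - Real.exp (-J) ≤ J := by linarith [Real.add_one_le_exp (-J)]
      refine h3.trans (hJ.trans (mul_le_mul_of_nonneg_left ?_ (by linarith)))
      exact Real.rpow_le_rpow (by positivity) hθr ha0.le
    have h2 := intervalIntegral.norm_integral_le_of_norm_le_const hbound
    have h4 : (2 : ℝ) ^ a ≤ 4 := by
      refine (Real.rpow_le_rpow_of_exponent_le one_le_two ha2).trans_eq ?_
      norm_num
    refine h1.trans ((mul_le_mul_of_nonneg_left h2 (by positivity)).trans ?_)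
    rw [Real.mul_rpow (by norm_num) (by positivity),
      show 2 * y⁻¹ - -2 * y⁻¹ = 4 * y⁻¹ by ring, abs_of_pos (by positivity)]
    -- The factor `8` is `(y / 2) * (4 / y) = 2` times `2 ^ a ≤ 4`.
    calc 2⁻¹ * y * (C * (2 ^ a * (r / y) ^ a) * (4 * y⁻¹))
        = 2 ^ a * (2 * C * (r / y) ^ a) := by
          field_simp
          ring
      _ ≤ 4 * (2 * C * (r / y) ^ a) := by gcongr
      _ = 8 * C * (r / y) ^ a := by ring

end Increments

end Multistable

theorem proposition11 {Ω : Type*} [MeasurableSpace Ω] (P : Measure Ω) [IsProbabilityMeasure P]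
    (a b H lam : ℝ) (ha : 1 < a) (hab : a ≤ b) (hb : b ≤ 2)
    (hH0 : 0 < H) (hH1 : H < 1) (hlam : 0 < lam) (hHa : 1 < H * a)
    (α : ℝ → ℝ) (hα : AEMeasurable α volume) (hα_mem : ∀ x, α x ∈ Set.Icc a b)
    (X : ℝ → Ω → ℝ) (hX : Multistable.IsLTFmSM P H α lam X) :
    ∃ Y : ℝ → Ω → ℝ,
      (∀ t, Measurable (Y t)) ∧
      (∀ t, ∀ᵐ ω ∂P, Y t ω = X t ω) ∧
      (∀ ω, Continuous fun t => Y t ω) ∧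
      ∀ β : ℝ≥0, 0 < β → (β : ℝ) < H - 1 / a →
        ∀ᵐ ω ∂P, ∀ c d : ℝ, ∃ C : ℝ≥0,
          HolderOnWith C β (fun t => Y t ω) (Set.Icc c d) := by
  have ha0 : 0 < a := by linarith
  have hC := Multistable.eight_le_majorant_const ha0 hH1
  have hHa' : 0 < H - 1 / a := by
    rw [sub_pos, div_lt_iff₀ ha0]
    exact hHa
  exact Multistable.exists_continuous_modification_of_tail_le ha0
    (C := 8 * (8 + 4 / (a * (1 - H)))) (by linarith) hHa' hX.measurable
    fun s t y hy => hX.measureReal_increment_le ha.le hH1 hlam.le hHa.le hα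
      (fun x => ⟨(hα_mem x).1, (hα_mem x).2.trans hb⟩) s t hy
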